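/- Let $K$ be a field of characteristic $0$ and let $d\ge 2$. For $r\ge 0$ let $F_r$ be the free metabelian associative unitary $K$-algebra on $x_1,\dots,x_r$, i.e. the relatively free algebra defined by the identity $[x_1,x_2][x_3,x_4]=0$, and let $F_r'$ be its commutator ideal (the two-sided ideal generated by all commutators $[a,b]=ab-ba$). Let $U_r=\{u_1,\dots,u_r\}$ and $V_r=\{v_1,\dots,v_r\}$ be sets of commuting variables. The polynomial algebra $K[U_r,V_r]$ acts on $F_r'$ by \[ w\,u_i=x_iw,\qquad w\,v_i=[w,x_i]=wx_i-x_iw\qquad(w\in F_r',\ 1\le i\le r). \] Let $\delta$ be a Weitzenböck derivation of $F_d$, that is, a derivation with $\delta(x_j)=\sum_{i=1}^d\alpha_{ij}x_i$ ($\alpha_{ij}\in K$) where $(\alpha_{ij})$ is a nonzero nilpotent matrix. Assume that the span $KX_{d-1}$ of $x_1,\dots,x_{d-1}$ is $\delta$-invariant and that $\delta(x_d)=0$ (this holds in particular if $x_1,\dots,x_d$ is a Jordan basis for $\delta$ in which $x_d$ corresponds to a $1\times1$ cell). Let $\delta$ also denote the derivation of $K[U_d,V_d]$ with $\delta(u_j)=\sum_i\alpha_{ij}u_i$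 and $\delta(v_j)=\sum_i\alpha_{ij}v_i$, and the induced derivations of $F_{d-1}$ and $K[U_{d-1},V_{d-1}]$. A superscript $\delta$ denotes the kernel of $\delta$ (the constants); then $(F_r')^\delta$ is a $K[U_r,V_r]^\delta$-module for $r=d-1,d$. Let $\pi$ be the $K$-linear map from $K[U_{d-1},V_{d-1}]$ to $F_d'$ with \[ \pi(u_{i_1}\cdots u_{i_p}v_{j_1}\cdots v_{j_q})=\sum_{k=1}^{q}[x_d,x_{j_k}]\,u_{i_1}\cdots u_{i_p}\,v_{j_1}\cdots v_{j_{k-1}}v_{j_{k+1}}\cdots v_{j_q} \] for all $p,q\ge0$ (so $\pi$ vanishes on the monomials with $q=0$). Let $\{c_1,\dots,c_m\}$ be a generating set of the $K[U_{d-1},V_{d-1}]^\delta$-module $(F_{d-1}')^\delta$ consisting of elements that are homogeneous with respect to the total degree in $x_1,\dots,x_{d-1}$. Let $\{e_1,\dots,e_k,f_1,\dots,f_l\}$ be a generating set of the algebra $K[U_{d-1},V_{d-1}]^\delta$ such that no $e_i$ depends on $V_{d-1}$ and every monomial of every $f_j$ contains a variable from $V_{d-1}$. Then, with $F_{d-1}$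 regarded as the subalgebra of $F_d$ generated by $x_1,\dots,x_{d-1}$, the $K[U_d,V_d]^\delta$-module $(F_d')^\delta$ is generated by \[ \{c_1,\dots,c_m\}\cup\{\pi(f_1),\dots,\pi(f_l)\}. \] -/

import Mathlib

noncomputable section

/-- The metabelian relations: `[a, b] [c, e] = 0` for all elements of the free associative algebra. -/
inductive MetabelianRel (K : Type*) [Field K] (ι : Type*) :
    FreeAlgebra K ι → FreeAlgebra K ι → Prop
  | mk (a b c e : FreeAlgebra K ι) :
      MetabelianRel K ι ((a * b - b * a) * (c * e - e * c)) 0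

/-- The free metabelian associative (unitary) algebra on the set `ι`: the relatively free algebra
of the variety defined by the polynomial identity `[x₁, x₂] [x₃, x₄] = 0`. -/
def FreeMetabelian (K : Type*) [Field K] (ι : Type*) : Type _ :=
  RingQuot (MetabelianRel K ι)

namespace FreeMetabelian

variable (K : Type*) [Field K] {ι κ : Type*}

instance instRing : Ring (FreeMetabelian K ι) :=
  inferInstanceAs (Ring (RingQuot (MetabelianRel K ι)))

instance instAlgebra : Algebra K (FreeMetabelian K ι) :=
  inferInstanceAs (Algebra K (RingQuot (MetabelianRel K ι)))

/-- The quotient map from the free associative algebra. -/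
def mk : FreeAlgebra K ι →ₐ[K] FreeMetabelian K ι :=
  RingQuot.mkAlgHom K (MetabelianRel K ι)

/-- The free generators `x i`. -/
def x (i : ι) : FreeMetabelian K ι := mk K (FreeAlgebra.ι K i)

theorem mk_surjective : Function.Surjective (mk K (ι := ι)) :=
  RingQuot.mkAlgHom_surjective K (MetabelianRel K ι)

variable {K}

theorem metabelian (a b c e : FreeMetabelian K ι) :
    (a * b - b * a) * (c * e - e * c) = 0 := by
  obtain ⟨a, rfl⟩ := mk_surjective K a
  obtain ⟨b, rfl⟩ := mk_surjective K b
  obtain ⟨c, rfl⟩ := mk_surjective K c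
  obtain ⟨e, rfl⟩ := mk_surjective K e
  have h := RingQuot.mkAlgHom_rel K (MetabelianRel.mk a b c e)
  rw [map_zero] at h
  have h' : mk K ((a * b - b * a) * (c * e - e * c)) = 0 := h
  simpa only [map_mul, map_sub] using h'

/-- The universal property of the free metabelian algebra. -/
def lift {B : Type*} [Ring B] [Algebra K B] (g : ι → B)
    (hB : ∀ a b c e : FreeAlgebra K ι,
      FreeAlgebra.lift K g ((a * b - b * a) * (c * e - e * c)) = 0) :
    FreeMetabelian K ι →ₐ[K] B :=
  RingQuot.liftAlgHom K ⟨FreeAlgebra.lift K g, by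
    rintro _ _ ⟨a, b, c, e⟩
    rw [hB, map_zero]⟩

theorem lift_mk {B : Type*} [Ring B] [Algebra K B] (g : ι → B)
    (hB : ∀ a b c e : FreeAlgebra K ι,
      FreeAlgebra.lift K g ((a * b - b * a) * (c * e - e * c)) = 0) (a : FreeAlgebra K ι) :
    lift g hB (mk K a) = FreeAlgebra.lift K g a :=
  RingQuot.liftAlgHom_mkAlgHom_apply K _ _ _

theorem lift_x {B : Type*} [Ring B] [Algebra K B] (g : ι → B)
    (hB : ∀ a b c e : FreeAlgebra K ι,
      FreeAlgebra.lift K g ((a * b - b * a) * (c * e - e * c)) = 0) (i : ι) :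
    lift g hB (x K i) = g i := by
  rw [x, lift_mk, FreeAlgebra.lift_ι_apply]

/-- The algebra homomorphism `x i ↦ x (f i)`. -/
def map (f : ι → κ) : FreeMetabelian K ι →ₐ[K] FreeMetabelian K κ :=
  lift (fun i => x K (f i)) fun a b c e => by
    simp only [map_mul, map_sub]
    exact metabelian _ _ _ _

variable (K) in
/-- The homogeneous component of degree `n`: the span of the products of `n` generators. -/
def component (ι : Type*) (n : ℕ) : Submodule K (FreeMetabelian K ι) :=
  Submodule.span K (Set.range (x K)) ^ n

/-! The derivation of the free metabelian algebra that is given on the generators by a matrix. -/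

section derivation

variable [Fintype ι]

/-- The algebra homomorphism `w ↦ w + ε δ(w)` into the algebra of dual numbers over the free
metabelian algebra, where `δ (x j) = ∑ i, A i j • x i`. -/
def dualHom (A : Matrix ι ι K) :
    FreeMetabelian K ι →ₐ[K] TrivSqZeroExt (FreeMetabelian K ι) (FreeMetabelian K ι) :=
  lift (fun j => TrivSqZeroExt.inl (x K j) + TrivSqZeroExt.inr (∑ i, A i j • x K i))
    fun a b c e => by
      simp only [map_mul, map_sub]
      set φ := FreeAlgebra.lift K (fun j => (TrivSqZeroExt.inl (x K j) +
        TrivSqZeroExt.inr (∑ i, A i j • x K i) :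
          TrivSqZeroExt (FreeMetabelian K ι) (FreeMetabelian K ι)))
      generalize φ a = a
      generalize φ b = b
      generalize φ c = c
      generalize φ e = e
      have key : ∀ p q : TrivSqZeroExt (FreeMetabelian K ι) (FreeMetabelian K ι),
          (p * q - q * p).snd = (p.fst * q.snd - q.snd * p.fst)
            + (p.snd * q.fst - q.fst * p.snd) := by
        intro p q
        simp only [TrivSqZeroExt.snd_sub, TrivSqZeroExt.snd_mul, smul_eq_mul,
          MulOpposite.smul_eq_mul_unop, MulOpposite.unop_op]
        abel
      apply TrivSqZeroExt.ext
      · simp only [TrivSqZeroExt.fst_mul, TrivSqZeroExt.fst_sub, TrivSqZeroExt.fst_zero]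
        exact metabelian _ _ _ _
      · rw [TrivSqZeroExt.snd_mul, key, key]
        simp only [TrivSqZeroExt.fst_mul, TrivSqZeroExt.fst_sub, TrivSqZeroExt.snd_zero,
          smul_eq_mul, MulOpposite.smul_eq_mul_unop, MulOpposite.unop_op, mul_add, add_mul,
          metabelian, add_zero]

theorem fst_dualHom (A : Matrix ι ι K) (w : FreeMetabelian K ι) : (dualHom A w).fst = w := by
  obtain ⟨a, rfl⟩ := mk_surjective K w
  rw [dualHom, lift_mk]
  induction a using FreeAlgebra.induction with
  | grade0 r => simp [AlgHom.commutes, TrivSqZeroExt.algebraMap_eq_inl']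
  | grade1 i => simp [FreeAlgebra.lift_ι_apply, x]
  | mul a b ha hb => simp only [map_mul, TrivSqZeroExt.fst_mul, ha, hb]
  | add a b ha hb => simp only [map_add, TrivSqZeroExt.fst_add, ha, hb]

/-- The derivation `δ` of the free metabelian algebra with `δ (x j) = ∑ i, A i j • x i`. -/
def derivation (A : Matrix ι ι K) : FreeMetabelian K ι →ₗ[K] FreeMetabelian K ι :=
  (TrivSqZeroExt.sndHom (FreeMetabelian K ι) (FreeMetabelian K ι)).restrictScalars K ∘ₗ
    (dualHom A).toLinearMap

theorem derivation_x (A : Matrix ι ι K) (j : ι) :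
    derivation A (x K j) = ∑ i, A i j • x K i := by
  change (dualHom A (x K j)).snd = _
  rw [dualHom, lift_x]
  simp

theorem derivation_mul (A : Matrix ι ι K) (a b : FreeMetabelian K ι) :
    derivation A (a * b) = derivation A a * b + a * derivation A b := by
  change (dualHom A (a * b)).snd = (dualHom A a).snd * b + a * (dualHom A b).snd
  rw [map_mul, TrivSqZeroExt.snd_mul, fst_dualHom, fst_dualHom, add_comm]
  rfl

end derivation

/-! The commutator ideal. -/

variable (K ι) in
/-- The two-sided ideal generated by all commutators. -/
def commTwoSidedIdeal : TwoSidedIdeal (FreeMetabelian K ι) :=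
  TwoSidedIdeal.span {w | ∃ a b : FreeMetabelian K ι, w = a * b - b * a}

variable (K ι) in
/-- The commutator ideal as a vector space: the two-sided ideal generated by all commutators. -/
def commIdeal : Submodule K (FreeMetabelian K ι) where
  carrier := commTwoSidedIdeal K ι
  add_mem' := fun ha hb => TwoSidedIdeal.add_mem (commTwoSidedIdeal K ι) ha hb
  zero_mem' := TwoSidedIdeal.zero_mem (commTwoSidedIdeal K ι)
  smul_mem' := fun c w hw => by
    rw [Algebra.smul_def]
    exact TwoSidedIdeal.mul_mem_left (commTwoSidedIdeal K ι) _ _ hw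

theorem commutator_mem (a b : FreeMetabelian K ι) : a * b - b * a ∈ commIdeal K ι :=
  TwoSidedIdeal.subset_span
    (s := {w | ∃ a b : FreeMetabelian K ι, w = a * b - b * a}) ⟨a, b, rfl⟩

/-- The commutator `[a, b]` as an element of the commutator ideal. -/
def comm (a b : FreeMetabelian K ι) : commIdeal K ι := ⟨a * b - b * a, commutator_mem a b⟩

theorem commIdeal_mul_left (a : FreeMetabelian K ι) {w : FreeMetabelian K ι}
    (hw : w ∈ commIdeal K ι) : a * w ∈ commIdeal K ι :=
  TwoSidedIdeal.mul_mem_left (commTwoSidedIdeal K ι) _ _ hw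

theorem commIdeal_mul_right (a : FreeMetabelian K ι) {w : FreeMetabelian K ι}
    (hw : w ∈ commIdeal K ι) : w * a ∈ commIdeal K ι :=
  TwoSidedIdeal.mul_mem_right (commTwoSidedIdeal K ι) _ _ hw

theorem commIdeal_induction {p : FreeMetabelian K ι → Prop}
    (comm : ∀ a b, p (a * b - b * a)) (zero : p 0)
    (add : ∀ v w, v ∈ commIdeal K ι → w ∈ commIdeal K ι → p v → p w → p (v + w))
    (neg : ∀ w, w ∈ commIdeal K ι → p w → p (-w))
    (left : ∀ a w, w ∈ commIdeal K ι → p w → p (a * w))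
    (right : ∀ a w, w ∈ commIdeal K ι → p w → p (w * a))
    {w : FreeMetabelian K ι} (hw : w ∈ commIdeal K ι) : p w := by
  have hw' : w ∈ TwoSidedIdeal.span {w | ∃ a b : FreeMetabelian K ι, w = a * b - b * a} := hw
  clear hw
  induction hw' using TwoSidedIdeal.span_induction with
  | mem _ h => obtain ⟨a, b, rfl⟩ := h; exact comm a b
  | zero => exact zero
  | add v w hv hw pv pw => exact add v w hv hw pv pw
  | neg w hw pw => exact neg w hw pw
  | left_absorb a w hw pw => exact left a w hw pw
  | right_absorb a w hw pw => exact right a w hw pw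

theorem comm_mul_commIdeal (a b : FreeMetabelian K ι) {w : FreeMetabelian K ι}
    (hw : w ∈ commIdeal K ι) : (a * b - b * a) * w = 0 := by
  revert a b
  refine commIdeal_induction (p := fun w => ∀ a b, (a * b - b * a) * w = 0)
    (fun c e a b => metabelian a b c e) (fun a b => mul_zero _)
    (fun v w _ _ hv hw a b => by rw [mul_add, hv, hw, add_zero])
    (fun w _ hw a b => by rw [mul_neg, hw, neg_zero])
    (fun c w _ hw a b => ?_)
    (fun c w _ hw a b => by rw [← mul_assoc, hw, zero_mul]) hw
  have h : (a * b - b * a) * (c * w)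
      = (a * (b * c) - b * c * a) * w - b * ((a * c - c * a) * w) := by noncomm_ring
  rw [h, hw, hw, mul_zero, sub_zero]

theorem commIdeal_mul_comm (a b : FreeMetabelian K ι) {w : FreeMetabelian K ι}
    (hw : w ∈ commIdeal K ι) : w * (a * b - b * a) = 0 := by
  revert a b
  refine commIdeal_induction (p := fun w => ∀ a b, w * (a * b - b * a) = 0)
    (fun c e a b => metabelian c e a b) (fun a b => zero_mul _)
    (fun v w _ _ hv hw a b => by rw [add_mul, hv, hw, add_zero])
    (fun w _ hw a b => by rw [neg_mul, hw, neg_zero])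
    (fun c w _ hw a b => by rw [mul_assoc, hw, mul_zero])
    (fun c w _ hw a b => ?_) hw
  have h : w * c * (a * b - b * a)
      = w * (c * a * b - b * (c * a)) - w * (c * b - b * c) * a := by noncomm_ring
  rw [h, hw, hw, zero_mul, sub_zero]

/-! The action of the polynomial algebra `K[U, V]` on the commutator ideal. The variables of
`U` are `X (Sum.inl i)`, those of `V` are `X (Sum.inr i)`. -/

/-- The operators by which the variables act: `u i` sends `w` to `x i * w`, and `v i` sends `w`
to the commutator `[w, x i]`. -/
def operator : ι ⊕ ι → Module.End K (commIdeal K ι)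
  | Sum.inl i => (LinearMap.mulLeft K (x K i)).restrict
      fun _ hw => commIdeal_mul_left _ hw
  | Sum.inr i => (LinearMap.mulRight K (x K i) - LinearMap.mulLeft K (x K i)).restrict
      fun _ hw => Submodule.sub_mem _ (commIdeal_mul_right _ hw) (commIdeal_mul_left _ hw)

theorem operator_inl (i : ι) (w : commIdeal K ι) :
    (operator (Sum.inl i) w : FreeMetabelian K ι) = x K i * w := rfl

theorem operator_inr (i : ι) (w : commIdeal K ι) :
    (operator (Sum.inr i) w : FreeMetabelian K ι) = w * x K i - x K i * w := rfl

theorem operator_commute (s t : ι ⊕ ι) :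
    operator (K := K) s * operator t = operator t * operator s := by
  refine LinearMap.ext fun w => Subtype.ext ?_
  change (operator s (operator t w) : FreeMetabelian K ι) = operator t (operator s w)
  have hl : ∀ i j : ι, x K i * (x K j * w) = x K j * (x K i * w) := fun i j => by
    rw [← sub_eq_zero, ← comm_mul_commIdeal (x K i) (x K j) w.2]
    noncomm_ring
  have hr : ∀ i j : ι, w * x K i * x K j = w * x K j * x K i := fun i j => by
    rw [← sub_eq_zero, ← commIdeal_mul_comm (x K i) (x K j) w.2]
    noncomm_ring
  rcases s with i | i <;> rcases t with j | j <;>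
    simp only [operator_inl, operator_inr, mul_sub, sub_mul, ← mul_assoc] <;>
    have h1 := hl i j <;> have h2 := hr i j <;> simp only [← mul_assoc] at h1 h2
  · exact h1
  · rw [h1]
  · rw [h1]
  · rw [h1, h2]; abel

variable (K ι) in
/-- The (commutative) algebra generated by the operators of the variables. -/
abbrev operatorAlgebra : Subalgebra K (Module.End K (commIdeal K ι)) :=
  Algebra.adjoin K (Set.range operator)

instance instIsMulCommutative : IsMulCommutative (operatorAlgebra K ι) :=
  Algebra.isMulCommutative_adjoin K (by
    rintro _ ⟨s, rfl⟩ _ ⟨t, rfl⟩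
    exact operator_commute s t)

variable (K ι) in
open scoped IsMulCommutative in
/-- The algebra homomorphism that sends each variable to its operator. -/
def action : MvPolynomial (ι ⊕ ι) K →ₐ[K] Module.End K (commIdeal K ι) :=
  (operatorAlgebra K ι).val.comp
    (MvPolynomial.aeval fun s => (⟨operator s, Algebra.subset_adjoin ⟨s, rfl⟩⟩ : operatorAlgebra K ι))

open scoped IsMulCommutative in
theorem action_X (s : ι ⊕ ι) : action K ι (MvPolynomial.X s) = operator s := by
  rw [action, AlgHom.comp_apply, MvPolynomial.aeval_X]
  rfl

/-- The `K[U, V]`-module structure of the commutator ideal. -/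
instance instModule : Module (MvPolynomial (ι ⊕ ι) K) (commIdeal K ι) :=
  Module.compHom (commIdeal K ι) (action K ι).toRingHom

theorem smul_eq (p : MvPolynomial (ι ⊕ ι) K) (w : commIdeal K ι) : p • w = action K ι p w := rfl

theorem coe_X_inl_smul (i : ι) (w : commIdeal K ι) :
    (((MvPolynomial.X (Sum.inl i) : MvPolynomial (ι ⊕ ι) K) • w : commIdeal K ι) :
      FreeMetabelian K ι) = x K i * w := by
  rw [smul_eq, action_X, operator_inl]

theorem coe_X_inr_smul (i : ι) (w : commIdeal K ι) :
    (((MvPolynomial.X (Sum.inr i) : MvPolynomial (ι ⊕ ι) K) • w : commIdeal K ι) :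
      FreeMetabelian K ι) = w * x K i - x K i * w := by
  rw [smul_eq, action_X, operator_inr]

theorem C_smul (r : K) (w : commIdeal K ι) :
    (MvPolynomial.C r : MvPolynomial (ι ⊕ ι) K) • w = r • w := by
  rw [smul_eq, ← MvPolynomial.algebraMap_eq, AlgHom.commutes, Module.algebraMap_end_apply]

/-! Constants. -/

section constants

variable [Fintype ι] (A : Matrix ι ι K)

theorem derivation_mem {w : FreeMetabelian K ι} (hw : w ∈ commIdeal K ι) :
    derivation A w ∈ commIdeal K ι := by
  refine commIdeal_induction (p := fun w => derivation A w ∈ commIdeal K ι)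
    (fun a b => ?_) (by rw [map_zero]; exact Submodule.zero_mem _)
    (fun v w _ _ hv hw => by rw [map_add]; exact Submodule.add_mem _ hv hw)
    (fun w _ hw => by rw [map_neg]; exact Submodule.neg_mem _ hw)
    (fun a w hw hw' => ?_) (fun a w hw hw' => ?_) hw
  · have h : derivation A (a * b - b * a)
        = (derivation A a * b - b * derivation A a)
          + (a * derivation A b - derivation A b * a) := by
      rw [map_sub, derivation_mul, derivation_mul]
      abel
    rw [h]
    exact Submodule.add_mem _ (commutator_mem _ _) (commutator_mem _ _)
  · rw [derivation_mul]
    exact Submodule.add_mem _ (commIdeal_mul_left _ hw) (commIdeal_mul_left _ hw')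
  · rw [derivation_mul]
    exact Submodule.add_mem _ (commIdeal_mul_right _ hw') (commIdeal_mul_right _ hw)

/-- The restriction of the derivation `δ` to the commutator ideal. -/
def commDerivation : commIdeal K ι →ₗ[K] commIdeal K ι :=
  (derivation A).restrict fun _ hw => derivation_mem A hw

/-- The derivation `δ` of `K[U, V]`, which acts on `U` and on `V` as on the generators of the free
metabelian algebra: `δ (u j) = ∑ i, A i j • u i` and `δ (v j) = ∑ i, A i j • v i`. -/
def polyDerivation : Derivation K (MvPolynomial (ι ⊕ ι) K) (MvPolynomial (ι ⊕ ι) K) :=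
  MvPolynomial.mkDerivation K (Sum.elim
    (fun j => ∑ i, A i j • MvPolynomial.X (Sum.inl i))
    (fun j => ∑ i, A i j • MvPolynomial.X (Sum.inr i)))

/-- The algebra of constants `K[U, V]^δ`. -/
def polyConstants : Subalgebra K (MvPolynomial (ι ⊕ ι) K) where
  carrier := {p | polyDerivation A p = 0}
  mul_mem' := by
    intro p q hp hq
    have hp' : polyDerivation A p = 0 := hp
    have hq' : polyDerivation A q = 0 := hq
    change polyDerivation A (p * q) = 0
    rw [Derivation.leibniz, hp', hq', smul_zero, smul_zero, add_zero]
  add_mem' := by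
    intro p q hp hq
    have hp' : polyDerivation A p = 0 := hp
    have hq' : polyDerivation A q = 0 := hq
    change polyDerivation A (p + q) = 0
    rw [map_add, hp', hq', add_zero]
  algebraMap_mem' r := (polyDerivation A).map_algebraMap r

theorem commDerivation_smul (p : MvPolynomial (ι ⊕ ι) K) (w : commIdeal K ι) :
    commDerivation A (p • w) = polyDerivation A p • w + p • commDerivation A w := by
  induction p using MvPolynomial.induction_on generalizing w with
  | C r =>
    rw [C_smul, map_smul, C_smul, ← MvPolynomial.algebraMap_eq, Derivation.map_algebraMap,
      zero_smul, zero_add]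
  | add p q hp hq =>
    rw [add_smul, map_add, hp, hq, map_add, add_smul, add_smul]
    abel
  | mul_X p s hp =>
    have key : commDerivation A ((MvPolynomial.X s : MvPolynomial (ι ⊕ ι) K) • w)
        = polyDerivation A (MvPolynomial.X s) • w
          + (MvPolynomial.X s : MvPolynomial (ι ⊕ ι) K) • commDerivation A w := by
      have hs : ∀ f : ι → ι ⊕ ι, ∀ j : ι,
          (∑ i, A i j • (MvPolynomial.X (f i) : MvPolynomial (ι ⊕ ι) K)) • w
            = ∑ i, A i j • operator (f i) w := by
        intro f j
        rw [Finset.sum_smul]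
        refine Finset.sum_congr rfl fun i _ => ?_
        rw [MvPolynomial.smul_eq_C_mul, mul_smul, C_smul, smul_eq, action_X]
      rcases s with j | j
      · rw [polyDerivation, MvPolynomial.mkDerivation_X, Sum.elim_inl, hs]
        apply Subtype.ext
        rw [smul_eq, smul_eq, action_X, Submodule.coe_add, operator_inl]
        change derivation A (x K j * w) = _ + x K j * derivation A w
        rw [derivation_mul, derivation_x, Finset.sum_mul]
        simp only [Submodule.coe_sum, Submodule.coe_smul, operator_inl, smul_mul_assoc]
      · rw [polyDerivation, MvPolynomial.mkDerivation_X, Sum.elim_inr, hs]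
        apply Subtype.ext
        rw [smul_eq, smul_eq, action_X, Submodule.coe_add, operator_inr]
        change derivation A (w * x K j - x K j * w)
          = _ + (derivation A w * x K j - x K j * derivation A w)
        rw [map_sub, derivation_mul, derivation_mul, derivation_x, Finset.sum_mul, Finset.mul_sum]
        simp only [Submodule.coe_sum, Submodule.coe_smul, operator_inr, smul_sub,
          smul_mul_assoc, mul_smul_comm, Finset.sum_sub_distrib]
        abel
    rw [mul_smul, hp, key, Derivation.leibniz, add_smul, smul_add,
      smul_eq_mul, smul_eq_mul, mul_comm (MvPolynomial.X s), mul_smul, mul_smul, mul_smul]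
    abel

/-- The `K[U, V]^δ`-module of the constants of `δ` in the commutator ideal. -/
def commConstants : Submodule (polyConstants A) (commIdeal K ι) where
  carrier := {w | commDerivation A w = 0}
  add_mem' := by
    intro v w hv hw
    have hv' : commDerivation A v = 0 := hv
    have hw' : commDerivation A w = 0 := hw
    change commDerivation A (v + w) = 0
    rw [map_add, hv', hw', add_zero]
  zero_mem' := map_zero _
  smul_mem' := by
    intro p w hw
    have hp' : polyDerivation A p = 0 := p.2
    have hw' : commDerivation A w = 0 := hw
    change commDerivation A ((p : MvPolynomial (ι ⊕ ι) K) • w) = 0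
    rw [commDerivation_smul, hp', hw', zero_smul, smul_zero, add_zero]

end constants

/-! The passage from `d - 1` to `d` generators. -/

theorem map_mem (f : ι → κ) {w : FreeMetabelian K ι} (hw : w ∈ commIdeal K ι) :
    map f w ∈ commIdeal K κ := by
  refine commIdeal_induction (p := fun w => map f w ∈ commIdeal K κ)
    (fun a b => ?_) (by rw [map_zero]; exact Submodule.zero_mem _)
    (fun v w _ _ hv hw => by rw [map_add]; exact Submodule.add_mem _ hv hw)
    (fun w _ hw => by rw [map_neg]; exact Submodule.neg_mem _ hw)
    (fun a w _ hw => by rw [map_mul]; exact commIdeal_mul_left _ hw)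
    (fun a w _ hw => by rw [map_mul]; exact commIdeal_mul_right _ hw) hw
  rw [map_sub, map_mul, map_mul]
  exact commutator_mem _ _

variable (K) in
/-- The canonical map from the commutator ideal of the free metabelian algebra of rank `n` to that
of the free metabelian algebra of rank `n + 1`, induced by `x i ↦ x i` for the first `n`
generators. -/
def commInclusion (n : ℕ) : commIdeal K (Fin n) →ₗ[K] commIdeal K (Fin (n + 1)) :=
  (map (K := K) Fin.castSucc).toLinearMap.restrict fun _ hw => map_mem _ hw

variable (K) in
/-- The linear map `π` from the polynomials in the first `n` variables of `U` and of `V` to the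
commutator ideal of the free metabelian algebra of rank `n + 1`. It sends the monomial
`u_{i₁} ⋯ u_{iₘ} v_{j₁} ⋯ v_{jᵣ}` to the sum over `k = 1, …, r` of `[x_{n+1}, x_{jₖ}]` times the
monomial `u_{i₁} ⋯ u_{iₘ} v_{j₁} ⋯ v_{jᵣ}` with the factor `v_{jₖ}` left out (here the equal
summands are collected: `j` occurs `s (Sum.inr j)` times among `j₁, …, jᵣ`). In particular it is
zero on the monomials without variables of `V`. -/
def pi (n : ℕ) : MvPolynomial (Fin n ⊕ Fin n) K →ₗ[K] commIdeal K (Fin (n + 1)) :=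
  (MvPolynomial.basisMonomials (Fin n ⊕ Fin n) K).constr K fun s =>
    ∑ j : Fin n, s (Sum.inr j) •
      (MvPolynomial.rename (Sum.map Fin.castSucc Fin.castSucc)
          (MvPolynomial.monomial (s - Finsupp.single (Sum.inr j) 1) (1 : K)) •
        comm (x K (Fin.last n)) (x K j.castSucc))

end FreeMetabelian
end

/-!
Let `d = n + 1`. The commutator ideal of rank `d` is expanded with respect to the last generator:
every element is a sum, over the monomials `M` in the two last variables `u_d` and `v_d`, of terms
`M • (a + pi b)` with `a` in the commutator ideal of rank `n` and `b` a polynomial in the first `n`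
variables of `U` and of `V` in the range of the Euler derivation `vEuler` with respect to `V`.

Such an expansion exists (`expand_surjective`) because the Jacobi identity gives
`[x_d, x_i] v_j = [x_d, x_j] v_i` modulo the terms `M • a`, so that `pi (g v_j)` is there a positive
integer multiple of `g` times `[x_d, x_j]`, if `g` is a monomial. In characteristic zero one can
divide by it.

It is unique (`eq_zero_of_coord_sum_eq_zero`). The upper triangular matrices with diagonal entries
`u_j`, `u_j + v_j` and upper right entry `1` if `i = j` and `0` otherwise satisfy the metabelian
identity, and sending `x_j` to them yields a `K[U, V]`-linear coordinate `coord i` on the commutator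
ideal, with `[x_j, x_k]` mapped to `δ_ij v_k - δ_ik v_j`. The last coordinate is zero on the
elements `a` and turns `pi` into the Euler derivation (`coord_last_pi`), which is injective on its
own range.
The other coordinates determine `a`, by induction on the rank (`eq_zero_of_coord_eq_zero`).

The derivation `δ` is zero on `u_d` and `v_d` and commutes with the inclusion of rank `n` into rank
`d`, with `pi` and with the Euler derivation. By uniqueness, `δ` of a sum is zero only if all `a`
and `b` are constants (`exists_expand_of_mem_commConstants`). Then `a` is generated by the given
generators of the constants of rank `n`. As `pi` satisfies the Leibniz rule (`pi_mul`), `pi b` is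
generated by the values of `pi` on the algebra generators, and those without variables of `V`
contribute nothing.
-/

noncomputable section

namespace FreeMetabelian

open MvPolynomial (X C rename monomial)

variable {K : Type*} [Field K] {ι : Type*}

/-! ### Generators of the commutator ideal -/

@[elab_as_elim]
theorem induction {p : FreeMetabelian K ι → Prop}
    (algebraMap : ∀ r : K, p (algebraMap K (FreeMetabelian K ι) r))
    (x : ∀ i, p (x K i)) (mul : ∀ a b, p a → p b → p (a * b))
    (add : ∀ a b, p a → p b → p (a + b)) (w : FreeMetabelian K ι) : p w := by
  obtain ⟨a, rfl⟩ := mk_surjective K w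
  induction a using FreeAlgebra.induction with
  | grade0 r => rw [AlgHom.commutes]; exact algebraMap r
  | grade1 i => exact x i
  | mul a b ha hb => rw [map_mul]; exact mul _ _ ha hb
  | add a b ha hb => rw [map_add]; exact add _ _ ha hb

theorem comm_swap (a b : FreeMetabelian K ι) : comm b a = -comm a b :=
  Subtype.ext (neg_sub _ _).symm

theorem mul_left_mem_of_mem (S : Submodule (MvPolynomial (ι ⊕ ι) K) (commIdeal K ι))
    (a : FreeMetabelian K ι) {w : commIdeal K ι} (hw : w ∈ S) :
    (⟨a * w, commIdeal_mul_left a w.2⟩ : commIdeal K ι) ∈ S := by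
  induction a using induction generalizing w with
  | algebraMap r =>
    convert S.smul_mem (C r) hw using 1
    rw [C_smul]
    exact Subtype.ext (Algebra.smul_def _ _).symm
  | x i =>
    convert S.smul_mem (X (Sum.inl i)) hw using 1
    exact Subtype.ext (coe_X_inl_smul i w).symm
  | mul a b ha hb =>
    convert ha (hb hw) using 1
    exact Subtype.ext (mul_assoc _ _ _)
  | add a b ha hb =>
    convert S.add_mem (ha hw) (hb hw) using 1
    exact Subtype.ext (add_mul _ _ _)

theorem mul_right_mem_of_mem (S : Submodule (MvPolynomial (ι ⊕ ι) K) (commIdeal K ι))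
    (a : FreeMetabelian K ι) {w : commIdeal K ι} (hw : w ∈ S) :
    (⟨w * a, commIdeal_mul_right a w.2⟩ : commIdeal K ι) ∈ S := by
  induction a using induction generalizing w with
  | algebraMap r =>
    convert S.smul_mem (C r) hw using 1
    rw [C_smul]
    exact Subtype.ext ((Algebra.commutes _ _).symm.trans (Algebra.smul_def _ _).symm)
  | x i =>
    convert S.smul_mem (X (Sum.inl i) + X (Sum.inr i)) hw using 1
    refine Subtype.ext ?_
    rw [add_smul, Submodule.coe_add, coe_X_inl_smul, coe_X_inr_smul, add_sub_cancel]
  | mul a b ha hb =>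
    convert hb (ha hw) using 1
    exact Subtype.ext (mul_assoc _ _ _).symm
  | add a b ha hb =>
    convert S.add_mem (ha hw) (hb hw) using 1
    exact Subtype.ext (mul_add _ _ _)

/-- As `comm · b` is a derivation, membership of its values has to be checked on the generators
only. -/
theorem comm_mem_of_comm_x_mem (S : Submodule (MvPolynomial (ι ⊕ ι) K) (commIdeal K ι))
    {b : FreeMetabelian K ι} (hb : ∀ i, comm (x K i) b ∈ S) (a : FreeMetabelian K ι) :
    comm a b ∈ S := by
  induction a using induction with
  | algebraMap r =>
    convert S.zero_mem using 1
    exact Subtype.ext (sub_eq_zero.2 (Algebra.commutes _ _))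
  | x i => exact hb i
  | mul a a' ha ha' =>
    convert S.add_mem (mul_left_mem_of_mem S a ha') (mul_right_mem_of_mem S a' ha) using 1
    refine Subtype.ext ?_
    change a * a' * b - b * (a * a') = a * (a' * b - b * a') + (a * b - b * a) * a'
    noncomm_ring
  | add a a' ha ha' =>
    convert S.add_mem ha ha' using 1
    refine Subtype.ext ?_
    change (a + a') * b - b * (a + a') = (a * b - b * a) + (a' * b - b * a')
    noncomm_ring

/-- The commutators of the generators generate the commutator ideal as a `K[U, V]`-module. -/
theorem span_comm_x :
    Submodule.span (MvPolynomial (ι ⊕ ι) K)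
      (Set.range fun p : ι × ι => comm (x K p.1) (x K p.2)) = ⊤ := by
  set S := Submodule.span (MvPolynomial (ι ⊕ ι) K)
      (Set.range fun p : ι × ι => comm (x K p.1) (x K p.2))
  have hS : ∀ a b : FreeMetabelian K ι, comm a b ∈ S := fun a b =>
    comm_mem_of_comm_x_mem S (fun i => by
      rw [comm_swap]
      exact S.neg_mem (comm_mem_of_comm_x_mem S
        (fun j => Submodule.subset_span ⟨(j, i), rfl⟩) b)) a
  refine eq_top_iff.2 fun w _ => ?_
  exact commIdeal_induction (p := fun w => ∀ hw : w ∈ commIdeal K ι, (⟨w, hw⟩ : commIdeal K ι) ∈ S)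
    (fun a b _ => hS a b) (fun _ => S.zero_mem)
    (fun v w hv hw pv pw _ => S.add_mem (pv hv) (pw hw))
    (fun w hw pw _ => S.neg_mem (pw hw))
    (fun a w hw pw _ => mul_left_mem_of_mem S a (pw hw))
    (fun a w hw pw _ => mul_right_mem_of_mem S a (pw hw)) w.2 w.2

/-- Induction on the commutator ideal, from the commutators of generators. -/
@[elab_as_elim]
theorem comm_induction {p : commIdeal K ι → Prop}
    (comm : ∀ i j, p (comm (x K i) (x K j))) (zero : p 0)
    (add : ∀ v w, p v → p w → p (v + w))
    (smul : ∀ (s : MvPolynomial (ι ⊕ ι) K) w, p w → p (s • w)) (w : commIdeal K ι) : p w := by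
  have hw : w ∈ Submodule.span (MvPolynomial (ι ⊕ ι) K)
      (Set.range fun p : ι × ι => FreeMetabelian.comm (x K p.1) (x K p.2)) := by
    rw [span_comm_x]; trivial
  induction hw using Submodule.span_induction with
  | mem _ h => obtain ⟨q, rfl⟩ := h; exact comm _ _
  | zero => exact zero
  | add v w _ _ hv hw => exact add v w hv hw
  | smul s w _ hw => exact smul s w hw

/-! ### Coordinates on the commutator ideal -/

section triangular

variable {R : Type*} [CommRing R] [Algebra K R] {g : ι → Matrix (Fin 2) (Fin 2) R}

theorem lift_one_zero (hg : ∀ i, g i 1 0 = 0) (a : FreeAlgebra K ι) :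
    FreeAlgebra.lift K g a 1 0 = 0 := by
  induction a using FreeAlgebra.induction with
  | grade0 r => simp [Matrix.algebraMap_matrix_apply]
  | grade1 i => simpa using hg i
  | mul a b ha hb => simp [Matrix.mul_apply, ha, hb]
  | add a b ha hb => simp [ha, hb]

/-- Upper triangular `2 × 2` matrices over a commutative algebra satisfy the metabelian identity,
hence every assignment of such matrices to the generators extends to a homomorphism. -/
def triangularHom (g : ι → Matrix (Fin 2) (Fin 2) R) (hg : ∀ i, g i 1 0 = 0) :
    FreeMetabelian K ι →ₐ[K] Matrix (Fin 2) (Fin 2) R :=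
  lift g fun a b c e => by
    have ha := lift_one_zero hg a
    have hb := lift_one_zero hg b
    have hc := lift_one_zero hg c
    have he := lift_one_zero hg e
    simp only [map_mul, map_sub]
    generalize FreeAlgebra.lift K g a = a at ha ⊢
    generalize FreeAlgebra.lift K g b = b at hb ⊢
    generalize FreeAlgebra.lift K g c = c at hc ⊢
    generalize FreeAlgebra.lift K g e = e at he ⊢
    ext i j
    fin_cases i <;> fin_cases j <;>
      simp [Matrix.mul_apply, Fin.sum_univ_two, ha, hb, hc, he, mul_comm (c _ _), mul_comm (a _ _)]

theorem triangularHom_x (hg : ∀ i, g i 1 0 = 0) (i : ι) :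
    triangularHom (K := K) g hg (x K i) = g i :=
  lift_x _ _ i

theorem triangularHom_one_zero (hg : ∀ i, g i 1 0 = 0) (a : FreeMetabelian K ι) :
    triangularHom g hg a 1 0 = 0 := by
  obtain ⟨a, rfl⟩ := mk_surjective K a
  rw [triangularHom, lift_mk]
  exact lift_one_zero hg a

theorem triangularHom_diag (hg : ∀ i, g i 1 0 = 0) {w : FreeMetabelian K ι}
    (hw : w ∈ commIdeal K ι) (i : Fin 2) : triangularHom g hg w i i = 0 := by
  have h := triangularHom_one_zero (K := K) hg
  revert i
  refine commIdeal_induction (p := fun w => ∀ i, triangularHom g hg w i i = 0)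
    (fun a b i => ?_) (fun i => by simp) (fun v w _ _ hv hw i => by simp [hv, hw])
    (fun w _ hw i => by simp [hw]) (fun a w _ hw i => ?_) (fun a w _ hw i => ?_) hw
  · fin_cases i <;> simp [Matrix.mul_apply, Fin.sum_univ_two, h, mul_comm]
  all_goals
    have h0 := hw 0
    have h1 := hw 1
    fin_cases i <;> simp [Matrix.mul_apply, Fin.sum_univ_two, h, h0, h1]

end triangular

section coord

variable [DecidableEq ι]

variable (K) in
/-- The matrices assigned to the generators `x j` in order to read off the `i`-th coordinate. -/
def coordMatrix (i j : ι) : Matrix (Fin 2) (Fin 2) (MvPolynomial (ι ⊕ ι) K) :=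
  !![X (Sum.inl j), if i = j then 1 else 0; 0, X (Sum.inl j) + X (Sum.inr j)]

variable (K) in
/-- The homomorphism into upper triangular matrices that is used for the `i`-th coordinate. -/
def coordHom (i : ι) : FreeMetabelian K ι →ₐ[K] Matrix (Fin 2) (Fin 2) (MvPolynomial (ι ⊕ ι) K) :=
  triangularHom (coordMatrix K i) fun _ => by simp [coordMatrix]

theorem coordHom_x (i j : ι) : coordHom K i (x K j) = coordMatrix K i j :=
  triangularHom_x _ j

theorem coordHom_diag (i : ι) {w : FreeMetabelian K ι} (hw : w ∈ commIdeal K ι) (a : Fin 2) :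
    coordHom K i w a a = 0 :=
  triangularHom_diag _ hw a

variable (K) in
/-- The `i`-th coordinate of an element of the commutator ideal: the upper right entry of its image
under `x j ↦ !![u j, δ i j; 0, u j + v j]`. Together the coordinates send `[x j, x k]` to
`v k • a j - v j • a k` in the free `K[U, V]`-module with basis `a`. -/
def coord (i : ι) : commIdeal K ι →ₗ[MvPolynomial (ι ⊕ ι) K] MvPolynomial (ι ⊕ ι) K where
  toFun w := coordHom K i w 0 1
  map_add' v w := by simp
  map_smul' p w := by
    have hl (j : ι) (w : commIdeal K ι) :
        coordHom K i (x K j * w) 0 1 =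
          X (Sum.inl j) * coordHom K i w 0 1 := by
      rw [map_mul, coordHom_x, Matrix.mul_apply, Fin.sum_univ_two,
        coordHom_diag i w.2, mul_zero, add_zero]
      rfl
    have hr (j : ι) (w : commIdeal K ι) :
        coordHom K i (w * x K j) 0 1 =
          coordHom K i w 0 1 *
            (X (Sum.inl j) + X (Sum.inr j)) := by
      rw [map_mul, coordHom_x, Matrix.mul_apply, Fin.sum_univ_two,
        coordHom_diag i w.2, zero_mul, zero_add]
      rfl
    rw [RingHom.id_apply, smul_eq_mul]
    induction p using MvPolynomial.induction_on generalizing w with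
    | C r =>
      rw [C_smul, Submodule.coe_smul, map_smul, Matrix.smul_apply, MvPolynomial.smul_eq_C_mul]
    | add p q hp hq =>
      rw [add_smul, Submodule.coe_add, map_add, Matrix.add_apply, hp, hq, add_mul]
    | mul_X p s hp =>
      rw [mul_smul, hp, mul_assoc]
      congr 1
      rcases s with j | j
      · rw [coe_X_inl_smul, hl]
      · rw [coe_X_inr_smul, map_sub, Matrix.sub_apply, hl, hr]
        ring

theorem coord_comm (i j k : ι) :
    coord K i (comm (x K j) (x K k)) =
      (if i = j then X (Sum.inr k) else 0) - if i = k then X (Sum.inr j) else 0 := by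
  change coordHom K i
    (x K j * x K k - x K k * x K j) 0 1 = _
  rw [map_sub, map_mul, map_mul, coordHom_x, coordHom_x]
  simp only [coordMatrix, Matrix.sub_apply, Matrix.mul_apply, Fin.sum_univ_two, Matrix.of_apply,
    Matrix.cons_val', Matrix.cons_val_zero, Matrix.cons_val_one, Matrix.cons_val_fin_one]
  split_ifs <;> ring

end coord

variable {n : ℕ}

/-! ### Adjoining one generator -/

variable (K n) in
/-- The inclusion of the polynomials in the first `n` variables of `U` and of `V`. -/
abbrev polyInclusion :
    MvPolynomial (Fin n ⊕ Fin n) K →ₐ[K] MvPolynomial (Fin (n + 1) ⊕ Fin (n + 1)) K :=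
  rename (Sum.map Fin.castSucc Fin.castSucc)

theorem map_x {ι κ : Type*} (f : ι → κ) (i : ι) : map f (x K i) = x K (f i) :=
  lift_x _ _ i

theorem coe_commInclusion (w : commIdeal K (Fin n)) :
    (commInclusion K n w : FreeMetabelian K (Fin (n + 1))) =
      map Fin.castSucc (w : FreeMetabelian K (Fin n)) :=
  rfl

theorem commInclusion_comm (i j : Fin n) :
    commInclusion K n (comm (x K i) (x K j)) = comm (x K i.castSucc) (x K j.castSucc) := by
  refine Subtype.ext ?_
  change map Fin.castSucc (x K i * x K j - x K j * x K i) = _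
  rw [map_sub, map_mul, map_mul, map_x, map_x]
  rfl

theorem commInclusion_smul (p : MvPolynomial (Fin n ⊕ Fin n) K) (w : commIdeal K (Fin n)) :
    commInclusion K n (p • w) = polyInclusion K n p • commInclusion K n w := by
  induction p using MvPolynomial.induction_on generalizing w with
  | C r => rw [C_smul, map_smul, polyInclusion, MvPolynomial.rename_C, C_smul]
  | add p q hp hq => rw [add_smul, map_add, hp, hq, map_add, add_smul]
  | mul_X p s hp =>
    rw [mul_smul, hp, map_mul, mul_smul, polyInclusion, MvPolynomial.rename_X]
    congr 1
    refine Subtype.ext ?_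
    rcases s with j | j
    · rw [coe_commInclusion, coe_X_inl_smul, map_mul, map_x, Sum.map_inl, coe_X_inl_smul,
        coe_commInclusion]
    · rw [coe_commInclusion, coe_X_inr_smul, map_sub, map_mul, map_mul, map_x, Sum.map_inr,
        coe_X_inr_smul, coe_commInclusion]

theorem coord_castSucc_commInclusion (i : Fin n) (w : commIdeal K (Fin n)) :
    coord K i.castSucc (commInclusion K n w) = polyInclusion K n (coord K i w) := by
  induction w using comm_induction with
  | comm j k =>
    rw [commInclusion_comm, coord_comm, coord_comm, map_sub, apply_ite (polyInclusion K n),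
      apply_ite (polyInclusion K n)]
    simp
  | zero => simp
  | add v w hv hw => simp only [map_add, hv, hw]
  | smul p w hw =>
    rw [commInclusion_smul, map_smul, map_smul, hw, smul_eq_mul, smul_eq_mul, map_mul]

theorem coord_last_commInclusion (w : commIdeal K (Fin n)) :
    coord K (Fin.last n) (commInclusion K n w) = 0 := by
  induction w using comm_induction with
  | comm j k =>
    rw [commInclusion_comm, coord_comm]
    simp [(Fin.castSucc_lt_last _).ne']
  | zero => simp
  | add v w hv hw => simp only [map_add, hv, hw, add_zero]
  | smul p w hw => rw [commInclusion_smul, map_smul, hw, smul_zero]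

/-- The Jacobi identity, as a relation of the `K[U, V]`-module. -/
theorem jacobi {ι : Type*} (i j k : ι) :
    (X (Sum.inr k) : MvPolynomial (ι ⊕ ι) K) • comm (x K i) (x K j) =
      (X (Sum.inr j) : MvPolynomial (ι ⊕ ι) K) • comm (x K i) (x K k)
        + (X (Sum.inr i) : MvPolynomial (ι ⊕ ι) K) • comm (x K k) (x K j) := by
  refine Subtype.ext ?_
  rw [Submodule.coe_add, coe_X_inr_smul, coe_X_inr_smul, coe_X_inr_smul]
  simp only [comm]
  noncomm_ring

/-! ### The Euler derivation and the map `pi` -/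

variable (K n) in
/-- The Euler derivation with respect to the variables of `V`: it multiplies each monomial by its
degree in the variables of `V`. -/
def vEuler : Derivation K (MvPolynomial (Fin n ⊕ Fin n) K) (MvPolynomial (Fin n ⊕ Fin n) K) :=
  MvPolynomial.mkDerivation K (Sum.elim 0 fun j => X (Sum.inr j))

theorem vEuler_monomial (s : Fin n ⊕ Fin n →₀ ℕ) (a : K) :
    vEuler K n (monomial s a) = (∑ j, s (Sum.inr j)) • monomial s a := by
  induction s using Finsupp.induction_linear generalizing a with
  | zero => simp [vEuler]
  | add s t hs ht =>
    have h : monomial (s + t) a = monomial s a * monomial t 1 := by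
      rw [MvPolynomial.monomial_mul, mul_one]
    rw [h, Derivation.leibniz, hs, ht]
    simp only [Finsupp.add_apply, Finset.sum_add_distrib, add_smul, smul_eq_mul, mul_smul_comm]
    rw [mul_comm (monomial t 1), add_comm]
  | single i k =>
    rw [MvPolynomial.monomial_eq, Finsupp.prod_single_index (by simp), ← MvPolynomial.smul_eq_C_mul,
      Derivation.map_smul, Derivation.leibniz_pow, smul_comm _ a]
    congr 1
    rcases k with _ | k
    · simp
    rcases i with i | i
    · simp [vEuler]
    · simp [vEuler, Finsupp.single_apply, pow_succ, Finset.sum_add_distrib]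

/-- The Euler derivation acts diagonally, with the degrees in the variables of `V` as
eigenvalues. -/
theorem coeff_vEuler (p : MvPolynomial (Fin n ⊕ Fin n) K) (s : Fin n ⊕ Fin n →₀ ℕ) :
    (vEuler K n p).coeff s = (∑ j, s (Sum.inr j)) • p.coeff s := by
  induction p using MvPolynomial.induction_on' with
  | monomial t a =>
    rw [vEuler_monomial, MvPolynomial.coeff_smul, MvPolynomial.coeff_monomial]
    split_ifs with h
    · rw [h]
    · simp
  | add p q hp hq => simp only [map_add, MvPolynomial.coeff_add, hp, hq, smul_add]

/-- The Euler derivation is diagonal on monomials, hence its kernel meets its range trivially. -/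
theorem vEuler_eq_zero_of_vEuler_vEuler [CharZero K] {p : MvPolynomial (Fin n ⊕ Fin n) K}
    (h : vEuler K n (vEuler K n p) = 0) : vEuler K n p = 0 := by
  ext s
  have hs := congrArg (MvPolynomial.coeff s) h
  rw [coeff_vEuler, MvPolynomial.coeff_zero, smul_eq_zero] at hs
  rcases hs with hs | hs
  · rw [coeff_vEuler, hs, zero_smul, MvPolynomial.coeff_zero]
  · exact hs

/-- The formula that defines `pi`, for monomials with arbitrary coefficients. -/
theorem pi_monomial (s : Fin n ⊕ Fin n →₀ ℕ) (a : K) :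
    pi K n (monomial s a) = ∑ j : Fin n, s (Sum.inr j) •
      (polyInclusion K n (monomial (s - Finsupp.single (Sum.inr j) 1) a) •
        comm (x K (Fin.last n)) (x K j.castSucc)) := by
  have h1 : pi K n (monomial s 1) = ∑ j : Fin n, s (Sum.inr j) •
      (polyInclusion K n (monomial (s - Finsupp.single (Sum.inr j) 1) 1) •
        comm (x K (Fin.last n)) (x K j.castSucc)) := by
    have := (MvPolynomial.basisMonomials (Fin n ⊕ Fin n) K).constr_basis K (fun s =>
      ∑ j : Fin n, s (Sum.inr j) •
        (polyInclusion K n (monomial (s - Finsupp.single (Sum.inr j) 1) (1 : K)) •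
          comm (x K (Fin.last n)) (x K j.castSucc))) s
    rwa [MvPolynomial.coe_basisMonomials] at this
  have h (t : Fin n ⊕ Fin n →₀ ℕ) : monomial t a = a • monomial t (1 : K) := by
    rw [MvPolynomial.smul_monomial, smul_eq_mul, mul_one]
  rw [h, map_smul, h1, Finset.smul_sum]
  refine Finset.sum_congr rfl fun j _ => ?_
  rw [h, map_smul, smul_comm, MvPolynomial.smul_eq_C_mul, mul_smul, C_smul]

theorem pi_X_inl (j : Fin n) : pi K n (X (Sum.inl j)) = 0 := by
  rw [MvPolynomial.X, pi_monomial]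
  simp

theorem pi_X_inr (j : Fin n) :
    pi K n (X (Sum.inr j)) = comm (x K (Fin.last n)) (x K j.castSucc) := by
  rw [MvPolynomial.X, pi_monomial, Finset.sum_eq_single j]
  · simp
  · intro i _ hi
    simp [hi.symm]
  · simp

/-- The map `pi` obeys the Leibniz rule. -/
theorem pi_mul (p q : MvPolynomial (Fin n ⊕ Fin n) K) :
    pi K n (p * q) = polyInclusion K n p • pi K n q + polyInclusion K n q • pi K n p := by
  induction p using MvPolynomial.induction_on' with
  | add p p' hp hp' =>
    simp only [add_mul, map_add, hp, hp', add_smul, smul_add]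
    abel
  | monomial s a =>
  induction q using MvPolynomial.induction_on' with
  | add q q' hq hq' =>
    simp only [mul_add, map_add, hq, hq', add_smul, smul_add]
    abel
  | monomial t b =>
    have key (s t : Fin n ⊕ Fin n →₀ ℕ) (a b : K) (j : Fin n) :
        t (Sum.inr j) • (polyInclusion K n
          (monomial (s + t - Finsupp.single (Sum.inr j) 1) (a * b)) •
            comm (x K (Fin.last n)) (x K j.castSucc)) =
        polyInclusion K n (monomial s a) • t (Sum.inr j) • (polyInclusion K n
          (monomial (t - Finsupp.single (Sum.inr j) 1) b) •
            comm (x K (Fin.last n)) (x K j.castSucc)) := by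
      by_cases ht : t (Sum.inr j) = 0
      · rw [ht, zero_smul, zero_smul, smul_zero]
      · rw [add_tsub_assoc_of_le (Finsupp.single_le_iff.2 (Nat.one_le_iff_ne_zero.2 ht)),
          ← MvPolynomial.monomial_mul, map_mul, mul_smul, smul_comm (t (Sum.inr j))]
    rw [MvPolynomial.monomial_mul, pi_monomial, pi_monomial, pi_monomial, Finset.smul_sum,
      Finset.smul_sum, ← Finset.sum_add_distrib]
    refine Finset.sum_congr rfl fun j _ => ?_
    rw [Finsupp.add_apply, add_smul, key, add_comm s t, mul_comm a b, key]
    exact add_comm _ _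

theorem pi_C (r : K) : pi K n (C r) = 0 := by
  rw [MvPolynomial.C_apply, pi_monomial]
  simp

theorem pi_eq_zero {p : MvPolynomial (Fin n ⊕ Fin n) K}
    (hp : ∀ s ∈ p.support, ∀ j : Fin n, s (Sum.inr j) = 0) : pi K n p = 0 := by
  rw [p.as_sum, map_sum]
  refine Finset.sum_eq_zero fun s hs => ?_
  rw [pi_monomial]
  exact Finset.sum_eq_zero fun j _ => by rw [hp s hs j, zero_smul]

/-- The last coordinate detects `pi`: it turns `pi` into the Euler derivation. -/
theorem coord_last_pi (p : MvPolynomial (Fin n ⊕ Fin n) K) :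
    coord K (Fin.last n) (pi K n p) = polyInclusion K n (vEuler K n p) := by
  induction p using MvPolynomial.induction_on with
  | C r => simp [pi_C, vEuler]
  | add p q hp hq => simp only [map_add, hp, hq]
  | mul_X p s hp =>
    rw [pi_mul, map_add, map_smul, map_smul, hp, Derivation.leibniz, map_add, smul_eq_mul,
      smul_eq_mul, smul_eq_mul, smul_eq_mul, map_mul, map_mul]
    congr 2
    rcases s with j | j
    · simp [pi_X_inl, vEuler]
    · rw [pi_X_inr, coord_comm]
      simp [vEuler, (Fin.castSucc_lt_last _).ne']

/-- In characteristic zero nothing is lost by restricting `pi` to the range of the Euler derivation,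
since `pi` is zero on the monomials without variables of `V`. -/
theorem exists_pi_vEuler_eq [CharZero K] (p : MvPolynomial (Fin n ⊕ Fin n) K) :
    ∃ q, pi K n (vEuler K n q) = pi K n p := by
  induction p using MvPolynomial.induction_on' with
  | add p p' hp hp' =>
    obtain ⟨q, hq⟩ := hp
    obtain ⟨q', hq'⟩ := hp'
    exact ⟨q + q', by simp only [map_add, hq, hq']⟩
  | monomial s a =>
    by_cases hs : ∑ j, s (Sum.inr j) = 0
    · refine ⟨0, ?_⟩
      rw [map_zero, map_zero, pi_monomial]
      refine (Finset.sum_eq_zero fun j hj => ?_).symm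
      rw [Finset.sum_eq_zero_iff.1 hs j hj, zero_smul]
    · refine ⟨monomial s ((∑ j, s (Sum.inr j) : ℕ) : K)⁻¹ * C a, ?_⟩
      rw [mul_comm, MvPolynomial.C_mul_monomial, vEuler_monomial, MvPolynomial.smul_monomial,
        nsmul_eq_mul, mul_left_comm, mul_inv_cancel₀ (Nat.cast_ne_zero.2 hs), mul_one]

/-! ### Compatibility with the derivations -/

section derivation

variable {A : Matrix (Fin (n + 1)) (Fin (n + 1)) K}

/-- A derivation that is linear in `V` preserves the degree in `V`, so it commutes with the Euler
derivation. -/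
theorem vEuler_polyDerivation (B : Matrix (Fin n) (Fin n) K) (p : MvPolynomial (Fin n ⊕ Fin n) K) :
    vEuler K n (polyDerivation B p) = polyDerivation B (vEuler K n p) := by
  have h : ⁅vEuler K n, polyDerivation B⁆ = 0 := by
    refine MvPolynomial.derivation_ext fun s => ?_
    rcases s with j | j <;> simp [Derivation.commutator_apply, vEuler, polyDerivation]
  rw [← sub_eq_zero, ← Derivation.commutator_apply, h, Derivation.zero_apply]

theorem polyDerivation_polyInclusion (hinv : ∀ j : Fin n, A (Fin.last n) j.castSucc = 0)
    (p : MvPolynomial (Fin n ⊕ Fin n) K) :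
    polyDerivation A (polyInclusion K n p) =
      polyInclusion K n (polyDerivation (A.submatrix Fin.castSucc Fin.castSucc) p) := by
  induction p using MvPolynomial.induction_on with
  | C r => simp [polyDerivation]
  | add p q hp hq => simp only [map_add, hp, hq]
  | mul_X p s hp =>
    rw [map_mul, Derivation.leibniz, Derivation.leibniz, hp, map_add, smul_eq_mul, smul_eq_mul,
      smul_eq_mul, smul_eq_mul, map_mul, map_mul]
    congr 2
    rcases s with j | j <;> simp [polyDerivation, Fin.sum_univ_castSucc, hinv]

theorem commDerivation_comm {ι : Type*} [Fintype ι] (A : Matrix ι ι K) (a b : FreeMetabelian K ι) :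
    commDerivation A (comm a b) = comm (derivation A a) b + comm a (derivation A b) := by
  refine Subtype.ext ?_
  change derivation A (a * b - b * a) = (derivation A a * b - b * derivation A a)
    + (a * derivation A b - derivation A b * a)
  rw [map_sub, derivation_mul, derivation_mul]
  abel

theorem comm_zero_left {ι : Type*} (a : FreeMetabelian K ι) : comm 0 a = 0 :=
  Subtype.ext (by simp [comm])

theorem comm_sum_smul_left {ι κ : Type*} [Fintype κ] (r : κ → K) (y : κ → FreeMetabelian K ι)
    (a : FreeMetabelian K ι) : comm (∑ i, r i • y i) a = ∑ i, r i • comm (y i) a :=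
  Subtype.ext (by simp [comm, Finset.sum_mul, Finset.mul_sum, smul_sub])

theorem comm_sum_smul_right {ι κ : Type*} [Fintype κ] (r : κ → K) (y : κ → FreeMetabelian K ι)
    (a : FreeMetabelian K ι) : comm a (∑ i, r i • y i) = ∑ i, r i • comm a (y i) :=
  Subtype.ext (by simp [comm, Finset.sum_mul, Finset.mul_sum, smul_sub])

theorem derivation_x_castSucc (hinv : ∀ j : Fin n, A (Fin.last n) j.castSucc = 0) (j : Fin n) :
    derivation A (x K j.castSucc) = ∑ i : Fin n, A i.castSucc j.castSucc • x K i.castSucc := by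
  rw [derivation_x, Fin.sum_univ_castSucc, hinv, zero_smul, add_zero]

theorem derivation_x_last (hlast : ∀ i, A i (Fin.last n) = 0) :
    derivation A (x K (Fin.last n)) = 0 := by
  simp [derivation_x, hlast]

theorem commDerivation_commInclusion (hinv : ∀ j : Fin n, A (Fin.last n) j.castSucc = 0)
    (w : commIdeal K (Fin n)) :
    commDerivation A (commInclusion K n w) =
      commInclusion K n (commDerivation (A.submatrix Fin.castSucc Fin.castSucc) w) := by
  induction w using comm_induction with
  | comm i j =>
    simp only [commInclusion_comm, commDerivation_comm, derivation_x_castSucc hinv, derivation_x,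
      comm_sum_smul_left, comm_sum_smul_right, map_add, map_sum, map_smul, Matrix.submatrix_apply]
  | zero => simp
  | add v w hv hw => simp only [map_add, hv, hw]
  | smul p w hw =>
    rw [commInclusion_smul, commDerivation_smul, hw, commDerivation_smul, map_add,
      commInclusion_smul, commInclusion_smul, polyDerivation_polyInclusion hinv]

theorem commDerivation_pi (hlast : ∀ i, A i (Fin.last n) = 0)
    (hinv : ∀ j : Fin n, A (Fin.last n) j.castSucc = 0) (p : MvPolynomial (Fin n ⊕ Fin n) K) :
    commDerivation A (pi K n p) =
      pi K n (polyDerivation (A.submatrix Fin.castSucc Fin.castSucc) p) := by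
  induction p using MvPolynomial.induction_on with
  | C r => simp [pi_C, polyDerivation]
  | add p q hp hq => simp only [map_add, hp, hq]
  | mul_X p s hp =>
    have hs : commDerivation A (pi K n (X s)) =
        pi K n (polyDerivation (A.submatrix Fin.castSucc Fin.castSucc) (X s)) := by
      rcases s with j | j
      · simp [pi_X_inl, polyDerivation]
      · simp [pi_X_inr, polyDerivation, commDerivation_comm, derivation_x_last hlast,
          comm_zero_left, derivation_x_castSucc hinv, comm_sum_smul_right]
    rw [pi_mul, map_add, commDerivation_smul, commDerivation_smul, hp, hs, Derivation.leibniz,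
      map_add, smul_eq_mul, smul_eq_mul, pi_mul, pi_mul, polyDerivation_polyInclusion hinv,
      polyDerivation_polyInclusion hinv]
    abel

end derivation

/-! ### Expansion with respect to the last variables -/

variable (K n) in
/-- The monomial `u ^ m false * v ^ m true` in the last variable `u` of `U` and the last variable
`v` of `V`. -/
def lastMonomial (m : Bool →₀ ℕ) : MvPolynomial (Fin (n + 1) ⊕ Fin (n + 1)) K :=
  rename (fun b => cond b (Sum.inr (Fin.last n)) (Sum.inl (Fin.last n))) (monomial m 1)

theorem lastMonomial_zero : lastMonomial K n 0 = 1 := by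
  simp [lastMonomial]

theorem lastMonomial_add (m m' : Bool →₀ ℕ) :
    lastMonomial K n (m + m') = lastMonomial K n m * lastMonomial K n m' := by
  rw [lastMonomial, lastMonomial, lastMonomial, ← map_mul, MvPolynomial.monomial_mul, mul_one]

theorem lastMonomial_single_false :
    lastMonomial K n (Finsupp.single false 1) = X (Sum.inl (Fin.last n)) :=
  MvPolynomial.rename_X _ _

theorem lastMonomial_single_true :
    lastMonomial K n (Finsupp.single true 1) = X (Sum.inr (Fin.last n)) :=
  MvPolynomial.rename_X _ _

/-- Every polynomial is a sum of monomials in the last variables times polynomials in the others. -/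
@[elab_as_elim]
theorem poly_induction {P : MvPolynomial (Fin (n + 1) ⊕ Fin (n + 1)) K → Prop}
    (mul : ∀ m q, P (lastMonomial K n m * polyInclusion K n q)) (add : ∀ p q, P p → P q → P (p + q))
    (p : MvPolynomial (Fin (n + 1) ⊕ Fin (n + 1)) K) : P p := by
  have hX (s) {p : MvPolynomial (Fin (n + 1) ⊕ Fin (n + 1)) K}
      (hp : p ∈ AddSubmonoid.closure
        (Set.range fun y : (Bool →₀ ℕ) × MvPolynomial (Fin n ⊕ Fin n) K =>
          lastMonomial K n y.1 * polyInclusion K n y.2)) :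
      p * X s ∈ AddSubmonoid.closure
        (Set.range fun y : (Bool →₀ ℕ) × MvPolynomial (Fin n ⊕ Fin n) K =>
          lastMonomial K n y.1 * polyInclusion K n y.2) := by
    induction hp using AddSubmonoid.closure_induction with
    | zero => rw [zero_mul]; exact zero_mem _
    | add p q _ _ hp hq => rw [add_mul]; exact add_mem hp hq
    | mem _ h =>
      obtain ⟨⟨m, q⟩, rfl⟩ := h
      apply AddSubmonoid.subset_closure
      rcases s with j | j
      · induction j using Fin.lastCases with
        | last =>
          refine ⟨(m + Finsupp.single false 1, q), ?_⟩
          simp only [lastMonomial_add, lastMonomial_single_false]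
          ring
        | cast j => exact ⟨(m, q * X (Sum.inl j)), by simp [mul_assoc]⟩
      · induction j using Fin.lastCases with
        | last =>
          refine ⟨(m + Finsupp.single true 1, q), ?_⟩
          simp only [lastMonomial_add, lastMonomial_single_true]
          ring
        | cast j => exact ⟨(m, q * X (Sum.inr j)), by simp [mul_assoc]⟩
  have hp : p ∈ AddSubmonoid.closure
      (Set.range fun y : (Bool →₀ ℕ) × MvPolynomial (Fin n ⊕ Fin n) K =>
        lastMonomial K n y.1 * polyInclusion K n y.2) := by
    induction p using MvPolynomial.induction_on with
    | C r =>
      exact AddSubmonoid.subset_closure ⟨(0, C r), by simp [lastMonomial_zero]⟩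
    | add p q hp hq => exact add_mem hp hq
    | mul_X p s hp => exact hX s hp
  induction hp using AddSubmonoid.closure_induction with
  | zero => simpa using mul 0 0
  | add p q _ _ hp hq => exact add p q hp hq
  | mem _ h => obtain ⟨y, rfl⟩ := h; exact mul _ _

variable (K n) in
/-- The homomorphism that regards a polynomial as a polynomial in the last variable `X false` of `U`
and the last variable `X true` of `V`, with coefficients that are polynomials in the others. -/
def lastExpansion : MvPolynomial (Fin (n + 1) ⊕ Fin (n + 1)) K →ₐ[K]
    MvPolynomial Bool (MvPolynomial (Fin n ⊕ Fin n) K) :=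
  MvPolynomial.aeval (Sum.elim
    (Fin.lastCases (motive := fun _ => MvPolynomial Bool (MvPolynomial (Fin n ⊕ Fin n) K))
      (X false) fun i => C (X (Sum.inl i)))
    (Fin.lastCases (motive := fun _ => MvPolynomial Bool (MvPolynomial (Fin n ⊕ Fin n) K))
      (X true) fun i => C (X (Sum.inr i))))

theorem lastExpansion_polyInclusion (p : MvPolynomial (Fin n ⊕ Fin n) K) :
    lastExpansion K n (polyInclusion K n p) = C p := by
  induction p using MvPolynomial.induction_on with
  | C r =>
    rw [polyInclusion, MvPolynomial.rename_C, ← MvPolynomial.algebraMap_eq, AlgHom.commutes]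
    rfl
  | add p q hp hq => simp only [map_add, hp, hq]
  | mul_X p s hp =>
    rw [map_mul, map_mul, hp, map_mul]
    congr 1
    rcases s with j | j <;> simp [lastExpansion]

theorem lastExpansion_lastMonomial (m : Bool →₀ ℕ) :
    lastExpansion K n (lastMonomial K n m) = monomial m 1 := by
  rw [lastExpansion, lastMonomial, MvPolynomial.aeval_rename, MvPolynomial.aeval_monomial,
    map_one, MvPolynomial.monomial_eq, map_one]
  congr 2
  funext b
  cases b <;> simp

/-- The monomials in the last variables are linearly independent over the polynomials in the
other variables. -/
theorem eq_zero_of_sum_lastMonomial_mul_eq_zero {s : Finset (Bool →₀ ℕ)}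
    {a : (Bool →₀ ℕ) → MvPolynomial (Fin n ⊕ Fin n) K}
    (h : ∑ m ∈ s, lastMonomial K n m * polyInclusion K n (a m) = 0) {m : Bool →₀ ℕ} (hm : m ∈ s) :
    a m = 0 := by
  have h' := congrArg (fun p => MvPolynomial.coeff m (lastExpansion K n p)) h
  simpa [lastExpansion_polyInclusion, lastExpansion_lastMonomial, MvPolynomial.coeff_sum,
    mul_comm _ (C _), MvPolynomial.coeff_monomial, hm] using h'

/-! ### Decomposition of the commutator ideal -/

/-- Up to elements coming from lower rank, `v j * pi p` is the product of `vEuler p` and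
`[x_d, x_j]`. This is where the Jacobi identity enters. -/
theorem exists_X_smul_pi (j : Fin n) (p : MvPolynomial (Fin n ⊕ Fin n) K) :
    ∃ w, (X (Sum.inr j.castSucc) : MvPolynomial (Fin (n + 1) ⊕ Fin (n + 1)) K) • pi K n p =
      polyInclusion K n (vEuler K n p) • comm (x K (Fin.last n)) (x K j.castSucc)
        + (X (Sum.inr (Fin.last n)) : MvPolynomial (Fin (n + 1) ⊕ Fin (n + 1)) K) •
          commInclusion K n w := by
  induction p using MvPolynomial.induction_on with
  | C r => exact ⟨0, by simp [pi_C, vEuler]⟩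
  | add p q hp hq =>
    obtain ⟨v, hv⟩ := hp
    obtain ⟨w, hw⟩ := hq
    refine ⟨v + w, ?_⟩
    simp only [map_add, smul_add, add_smul, hv, hw]
    abel
  | mul_X p s hp =>
    obtain ⟨w, hw⟩ := hp
    rcases s with k | k
    · refine ⟨(X (Sum.inl k) : MvPolynomial (Fin n ⊕ Fin n) K) • w, ?_⟩
      rw [pi_mul, pi_X_inl, smul_zero, zero_add, smul_comm, hw, commInclusion_smul, smul_add,
        smul_comm (polyInclusion K n (X (Sum.inl k))) (X (Sum.inr (Fin.last n))), smul_smul,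
        ← map_mul]
      congr 3
      simp [vEuler]
    · refine ⟨(X (Sum.inr k) : MvPolynomial (Fin n ⊕ Fin n) K) • w + p • comm (x K j) (x K k), ?_⟩
      have hE : vEuler K n (p * X (Sum.inr k)) =
          X (Sum.inr k) * vEuler K n p + p * X (Sum.inr k) := by
        rw [Derivation.leibniz, smul_eq_mul, smul_eq_mul, add_comm]
        simp [vEuler]
      rw [pi_mul, pi_X_inr, smul_add, smul_comm _ (polyInclusion K n p), jacobi,
        smul_comm _ (polyInclusion K n (X _)), hw, hE, map_add (commInclusion K n),
        commInclusion_smul, commInclusion_smul, commInclusion_comm, map_add, map_mul, map_mul,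
        add_smul, mul_smul, mul_smul, smul_add, smul_add, smul_add,
        smul_comm _ (X (Sum.inr (Fin.last n))), smul_comm _ (X (Sum.inr (Fin.last n)))]
      rw [polyInclusion, MvPolynomial.rename_X, Sum.map_inr]
      abel

theorem exists_vEuler_add_self_eq [CharZero K] (p : MvPolynomial (Fin n ⊕ Fin n) K) :
    ∃ q, vEuler K n q + q = p := by
  induction p using MvPolynomial.induction_on' with
  | add p p' hp hp' =>
    obtain ⟨q, rfl⟩ := hp
    obtain ⟨q', rfl⟩ := hp'
    exact ⟨q + q', by rw [map_add]; abel⟩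
  | monomial s a =>
    refine ⟨monomial s (((∑ j, s (Sum.inr j) + 1 : ℕ) : K)⁻¹ * a), ?_⟩
    rw [vEuler_monomial, ← succ_nsmul, MvPolynomial.smul_monomial, nsmul_eq_mul,
      mul_inv_cancel_left₀ (Nat.cast_ne_zero.2 (Nat.succ_ne_zero _))]

variable (K n) in
/-- The linear map that sends a family of pairs `(a m, b m)` to the sum over `m` of the products of
`lastMonomial m` with `a m + pi (vEuler (b m))`. -/
def expand : ((Bool →₀ ℕ) →₀ commIdeal K (Fin n) × MvPolynomial (Fin n ⊕ Fin n) K) →ₗ[K]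
    commIdeal K (Fin (n + 1)) :=
  Finsupp.lsum K fun m => action K (Fin (n + 1)) (lastMonomial K n m) ∘ₗ
    (commInclusion K n).coprod (pi K n ∘ₗ (vEuler K n).toLinearMap)

theorem expand_apply (a : (Bool →₀ ℕ) →₀ commIdeal K (Fin n) × MvPolynomial (Fin n ⊕ Fin n) K) :
    expand K n a = ∑ m ∈ a.support, lastMonomial K n m •
      (commInclusion K n (a m).1 + pi K n (vEuler K n (a m).2)) :=
  rfl

theorem expand_single (m : Bool →₀ ℕ) (y : commIdeal K (Fin n) × MvPolynomial (Fin n ⊕ Fin n) K) :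
    expand K n (Finsupp.single m y) =
      lastMonomial K n m • (commInclusion K n y.1 + pi K n (vEuler K n y.2)) :=
  Finsupp.lsum_single _ _ _ _

/-- Every element of the commutator ideal of rank `n + 1` has an expansion: modulo the terms from
lower rank, `[x_d, x_j]` times any polynomial is a value of `pi`. -/
theorem expand_surjective [CharZero K] : Function.Surjective (expand K n) := by
  have hι (m : Bool →₀ ℕ) (w : commIdeal K (Fin n)) :
      lastMonomial K n m • commInclusion K n w ∈ LinearMap.range (expand K n) :=
    ⟨Finsupp.single m (w, 0), by simp [expand_single]⟩
  have hπ (m : Bool →₀ ℕ) (p : MvPolynomial (Fin n ⊕ Fin n) K) :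
      lastMonomial K n m • pi K n p ∈ LinearMap.range (expand K n) := by
    obtain ⟨q, hq⟩ := exists_pi_vEuler_eq p
    exact ⟨Finsupp.single m (0, q), by simp [expand_single, hq]⟩
  have hlast (j : Fin n) (p : MvPolynomial (Fin (n + 1) ⊕ Fin (n + 1)) K) :
      p • comm (x K (Fin.last n)) (x K j.castSucc) ∈ LinearMap.range (expand K n) := by
    induction p using poly_induction with
    | add p q hp hq => rw [add_smul]; exact add_mem hp hq
    | mul m q =>
      obtain ⟨q, rfl⟩ := exists_vEuler_add_self_eq q
      obtain ⟨w, hw⟩ := exists_X_smul_pi j q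
      -- `[x_d, x_j]` times `vEuler q + q` is `pi (q v_j)` up to elements coming from lower rank
      have h : polyInclusion K n (vEuler K n q + q) • comm (x K (Fin.last n)) (x K j.castSucc) =
          pi K n (q * X (Sum.inr j)) -
            (X (Sum.inr (Fin.last n)) : MvPolynomial (Fin (n + 1) ⊕ Fin (n + 1)) K) •
              commInclusion K n w := by
        rw [pi_mul, pi_X_inr, eq_sub_iff_add_eq, polyInclusion, MvPolynomial.rename_X, Sum.map_inr,
          hw, map_add, add_smul]
        abel
      rw [mul_smul, h, smul_sub, smul_smul, ← lastMonomial_single_true, ← lastMonomial_add]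
      exact sub_mem (hπ _ _) (hι _ _)
  intro w
  have key : ∀ p : MvPolynomial (Fin (n + 1) ⊕ Fin (n + 1)) K,
      p • w ∈ LinearMap.range (expand K n) := by
    induction w using comm_induction with
    | zero => intro p; rw [smul_zero]; exact zero_mem _
    | add v w hv hw => intro p; rw [smul_add]; exact add_mem (hv p) (hw p)
    | smul q w hw => intro p; rw [smul_smul]; exact hw _
    | comm i j =>
      intro p
      induction i using Fin.lastCases with
      | last =>
        induction j using Fin.lastCases with
        | last =>
          have h : comm (x K (Fin.last n)) (x K (Fin.last n)) = 0 := Subtype.ext (sub_self _)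
          rw [h, smul_zero]
          exact zero_mem _
        | cast j => exact hlast j p
      | cast i =>
        induction j using Fin.lastCases with
        | last =>
          rw [comm_swap, smul_neg]
          exact neg_mem (hlast i p)
        | cast j =>
          induction p using poly_induction with
          | add p q hp hq => rw [add_smul]; exact add_mem hp hq
          | mul m q =>
            rw [mul_smul, ← commInclusion_comm, ← commInclusion_smul]
            exact hι _ _
  simpa using key 1

/-- Uniqueness of expansions, read off from the coordinates: the last coordinate sees only the
`pi` terms, and once these vanish the others see the terms from lower rank. The hypothesis `hn` is
the injectivity of the coordinates in lower rank. -/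
theorem eq_zero_of_coord_sum_eq_zero [CharZero K]
    (hn : ∀ w : commIdeal K (Fin n), (∀ i, coord K i w = 0) → w = 0) {s : Finset (Bool →₀ ℕ)}
    {a : (Bool →₀ ℕ) → commIdeal K (Fin n)} {b : (Bool →₀ ℕ) → MvPolynomial (Fin n ⊕ Fin n) K}
    (h : ∀ i, coord K i (∑ m ∈ s, lastMonomial K n m •
      (commInclusion K n (a m) + pi K n (vEuler K n (b m)))) = 0)
    {m : Bool →₀ ℕ} (hm : m ∈ s) : a m = 0 ∧ vEuler K n (b m) = 0 := by
  have hb : ∀ m ∈ s, vEuler K n (b m) = 0 := by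
    intro m hm
    have hl := h (Fin.last n)
    simp only [map_sum, map_smul, map_add, coord_last_commInclusion, coord_last_pi, zero_add,
      smul_eq_mul] at hl
    exact vEuler_eq_zero_of_vEuler_vEuler
      (eq_zero_of_sum_lastMonomial_mul_eq_zero (a := fun m => vEuler K n (vEuler K n (b m))) hl hm)
  refine ⟨hn _ fun i => ?_, hb m hm⟩
  have hi := h i.castSucc
  rw [Finset.sum_congr rfl fun m hm => by rw [hb m hm, map_zero, add_zero]] at hi
  simp only [map_sum, map_smul, coord_castSucc_commInclusion, smul_eq_mul] at hi
  exact eq_zero_of_sum_lastMonomial_mul_eq_zero (a := fun m => coord K i (a m)) hi hm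

/-- An element of the commutator ideal is determined by its coordinates. -/
theorem eq_zero_of_coord_eq_zero [CharZero K] (w : commIdeal K (Fin n))
    (hw : ∀ i, coord K i w = 0) : w = 0 := by
  induction n with
  | zero =>
    clear hw
    induction w using comm_induction with
    | comm i => exact i.elim0
    | zero => rfl
    | add v w hv hw => rw [hv, hw, add_zero]
    | smul p w hw => rw [hw, smul_zero]
  | succ n ih =>
    obtain ⟨a, rfl⟩ := expand_surjective w
    rw [expand_apply] at hw ⊢
    refine Finset.sum_eq_zero fun m hm => ?_
    obtain ⟨h1, h2⟩ := eq_zero_of_coord_sum_eq_zero (a := fun m => (a m).1) (b := fun m => (a m).2)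
      ih hw hm
    simp only [h1, h2, map_zero, add_zero, smul_zero]

/-! ### Constants -/

section constants

variable {A : Matrix (Fin (n + 1)) (Fin (n + 1)) K}

theorem mem_polyConstants {ι : Type*} [Fintype ι] {A : Matrix ι ι K}
    {p : MvPolynomial (ι ⊕ ι) K} : p ∈ polyConstants A ↔ polyDerivation A p = 0 :=
  Iff.rfl

theorem mem_commConstants {ι : Type*} [Fintype ι] {A : Matrix ι ι K}
    {w : commIdeal K ι} : w ∈ commConstants A ↔ commDerivation A w = 0 :=
  Iff.rfl

theorem polyInclusion_mem (hinv : ∀ j : Fin n, A (Fin.last n) j.castSucc = 0)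
    {p : MvPolynomial (Fin n ⊕ Fin n) K}
    (hp : p ∈ polyConstants (A.submatrix Fin.castSucc Fin.castSucc)) :
    polyInclusion K n p ∈ polyConstants A := by
  rw [mem_polyConstants] at hp ⊢
  rw [polyDerivation_polyInclusion hinv, hp, map_zero]

theorem lastMonomial_mem (hlast : ∀ i, A i (Fin.last n) = 0) (m : Bool →₀ ℕ) :
    lastMonomial K n m ∈ polyConstants A := by
  rw [lastMonomial, MvPolynomial.monomial_eq, map_one, one_mul, Finsupp.prod, map_prod]
  refine Subalgebra.prod_mem _ fun b _ => ?_
  rw [map_pow, MvPolynomial.rename_X]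
  refine Subalgebra.pow_mem _ (mem_polyConstants.2 ?_) _
  cases b <;> simp [polyDerivation, hlast]

/-- The components of a constant are constants: the derivation acts on the components of an
expansion, and these are unique. -/
theorem exists_expand_of_mem_commConstants [CharZero K] (hlast : ∀ i, A i (Fin.last n) = 0)
    (hinv : ∀ j : Fin n, A (Fin.last n) j.castSucc = 0) {w : commIdeal K (Fin (n + 1))}
    (hw : w ∈ commConstants A) :
    ∃ (s : Finset (Bool →₀ ℕ)) (a : (Bool →₀ ℕ) → commIdeal K (Fin n))
      (b : (Bool →₀ ℕ) → MvPolynomial (Fin n ⊕ Fin n) K),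
      w = ∑ m ∈ s, lastMonomial K n m • (commInclusion K n (a m) + pi K n (b m)) ∧
      ∀ m ∈ s, a m ∈ commConstants (A.submatrix Fin.castSucc Fin.castSucc) ∧
        b m ∈ polyConstants (A.submatrix Fin.castSucc Fin.castSucc) := by
  obtain ⟨a, rfl⟩ := expand_surjective w
  refine ⟨a.support, fun m => (a m).1, fun m => vEuler K n (a m).2, expand_apply a, fun m hm => ?_⟩
  rw [mem_commConstants, expand_apply, map_sum] at hw
  have hw' : ∑ m ∈ a.support, lastMonomial K n m •
      (commInclusion K n (commDerivation (A.submatrix Fin.castSucc Fin.castSucc) (a m).1)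
        + pi K n (vEuler K n
          (polyDerivation (A.submatrix Fin.castSucc Fin.castSucc) (a m).2))) = 0 := by
    rw [← hw]
    refine Finset.sum_congr rfl fun m _ => ?_
    rw [commDerivation_smul, mem_polyConstants.1 (lastMonomial_mem hlast m), zero_smul, zero_add,
      map_add, commDerivation_commInclusion hinv, commDerivation_pi hlast hinv,
      vEuler_polyDerivation]
  rw [mem_commConstants, mem_polyConstants, ← vEuler_polyDerivation]
  exact eq_zero_of_coord_sum_eq_zero eq_zero_of_coord_eq_zero
    (a := fun m => commDerivation (A.submatrix Fin.castSucc Fin.castSucc) (a m).1)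
    (b := fun m => polyDerivation (A.submatrix Fin.castSucc Fin.castSucc) (a m).2)
    (fun i => by rw [hw', map_zero]) hm

/-- Constants of rank `n` act as constants in rank `n + 1`, so what a set spans over the former is
mapped into what its image spans over the latter. -/
theorem commInclusion_mem_of_mem_span (hinv : ∀ j : Fin n, A (Fin.last n) j.castSucc = 0)
    {S : Submodule (polyConstants A) (commIdeal K (Fin (n + 1)))} {c : Set (commIdeal K (Fin n))}
    (hc : ∀ w ∈ c, commInclusion K n w ∈ S) {w : commIdeal K (Fin n)}
    (hw : w ∈ Submodule.span (polyConstants (A.submatrix Fin.castSucc Fin.castSucc)) c) :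
    commInclusion K n w ∈ S := by
  induction hw using Submodule.span_induction with
  | mem w hw => exact hc w hw
  | zero => rw [map_zero]; exact S.zero_mem
  | add v w _ _ hv hw => rw [map_add]; exact S.add_mem hv hw
  | smul p w _ hw =>
    have h := S.smul_mem ⟨_, polyInclusion_mem hinv p.2⟩ hw
    change polyInclusion K n (p : MvPolynomial (Fin n ⊕ Fin n) K) • commInclusion K n w ∈ S at h
    rwa [← commInclusion_smul] at h

/-- By the Leibniz rule, the values of `pi` on an algebra of constants are generated by the values
on algebra generators. -/
theorem pi_mem_of_mem_adjoin (hinv : ∀ j : Fin n, A (Fin.last n) j.castSucc = 0)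
    {S : Submodule (polyConstants A) (commIdeal K (Fin (n + 1)))}
    {g : Set (MvPolynomial (Fin n ⊕ Fin n) K)}
    (hgB : Algebra.adjoin K g = polyConstants (A.submatrix Fin.castSucc Fin.castSucc))
    (hg : ∀ p ∈ g, pi K n p ∈ S) {p : MvPolynomial (Fin n ⊕ Fin n) K}
    (hp : p ∈ Algebra.adjoin K g) : pi K n p ∈ S := by
  induction hp using Algebra.adjoin_induction with
  | mem p hp => exact hg p hp
  | algebraMap r => rw [MvPolynomial.algebraMap_eq, pi_C]; exact S.zero_mem
  | add p q _ _ hp hq => rw [map_add]; exact S.add_mem hp hq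
  | mul p q hp hq hp' hq' =>
    rw [hgB] at hp hq
    rw [pi_mul]
    exact S.add_mem (S.smul_mem ⟨_, polyInclusion_mem hinv hp⟩ hq')
      (S.smul_mem ⟨_, polyInclusion_mem hinv hq⟩ hp')

end constants

end FreeMetabelian

end

theorem mainTheorem3 {K : Type*} [Field K] [CharZero K] (n : ℕ)
    -- the Weitzenböck derivation `δ (x j) = ∑ i, A i j • x i` in `d = n + 1` variables
    (A : Matrix (Fin (n + 1)) (Fin (n + 1)) K) (hA : IsNilpotent A) (hA0 : A ≠ 0)
    -- `δ (x_d) = 0`, and the span of the first `d - 1` variables is invariant under `δ`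
    (hlast : ∀ i, A i (Fin.last n) = 0)
    (hinv : ∀ j : Fin n, A (Fin.last n) j.castSucc = 0)
    -- the restriction of `δ` to the first `d - 1` variables
    (B : Matrix (Fin n) (Fin n) K) (hB : B = A.submatrix Fin.castSucc Fin.castSucc)
    (m k l : ℕ)
    (c : Fin m → FreeMetabelian.commIdeal K (Fin n))
    (hc_hom : ∀ i, ∃ N : ℕ,
      (c i : FreeMetabelian K (Fin n)) ∈ FreeMetabelian.component K (Fin n) N)
    (hc : Submodule.span (FreeMetabelian.polyConstants B) (Set.range c) =
      FreeMetabelian.commConstants B)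
    (e : Fin k → MvPolynomial (Fin n ⊕ Fin n) K) (f : Fin l → MvPolynomial (Fin n ⊕ Fin n) K)
    (hef : Algebra.adjoin K (Set.range e ∪ Set.range f) = FreeMetabelian.polyConstants B)
    (he : ∀ i, ∀ s ∈ (e i).support, ∀ j : Fin n, s (Sum.inr j) = 0)
    (hf : ∀ i, ∀ s ∈ (f i).support, ∃ j : Fin n, s (Sum.inr j) ≠ 0) :
    Submodule.span (FreeMetabelian.polyConstants A)
        (Set.range (fun i => FreeMetabelian.commInclusion K n (c i)) ∪
          Set.range (fun i => FreeMetabelian.pi K n (f i))) =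
      FreeMetabelian.commConstants A := by
  subst hB
  apply le_antisymm
  · rw [Submodule.span_le]
    rintro _ (⟨i, rfl⟩ | ⟨i, rfl⟩)
    · have hi : c i ∈ FreeMetabelian.commConstants (A.submatrix Fin.castSucc Fin.castSucc) :=
        hc ▸ Submodule.subset_span ⟨i, rfl⟩
      rw [FreeMetabelian.mem_commConstants] at hi
      change FreeMetabelian.commDerivation A _ = 0
      rw [FreeMetabelian.commDerivation_commInclusion hinv, hi, map_zero]
    · have hi : f i ∈ FreeMetabelian.polyConstants (A.submatrix Fin.castSucc Fin.castSucc) :=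
        hef ▸ Algebra.subset_adjoin (Or.inr ⟨i, rfl⟩)
      rw [FreeMetabelian.mem_polyConstants] at hi
      change FreeMetabelian.commDerivation A _ = 0
      rw [FreeMetabelian.commDerivation_pi hlast hinv, hi, map_zero]
  · intro w hw
    obtain ⟨s, a, b, rfl, hab⟩ :=
      FreeMetabelian.exists_expand_of_mem_commConstants hlast hinv hw
    refine Submodule.sum_mem _ fun r hr => ?_
    obtain ⟨ha, hb⟩ := hab r hr
    rw [← hc] at ha
    rw [← hef] at hb
    refine Submodule.smul_mem _ (⟨_, FreeMetabelian.lastMonomial_mem hlast r⟩ :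
      FreeMetabelian.polyConstants A) (Submodule.add_mem _ ?_ ?_)
    · refine FreeMetabelian.commInclusion_mem_of_mem_span hinv ?_ ha
      rintro _ ⟨i, rfl⟩
      exact Submodule.subset_span (Or.inl ⟨i, rfl⟩)
    · refine FreeMetabelian.pi_mem_of_mem_adjoin hinv hef ?_ hb
      rintro _ (⟨i, rfl⟩ | ⟨i, rfl⟩)
      · rw [FreeMetabelian.pi_eq_zero (he i)]
        exact Submodule.zero_mem _
      · exact Submodule.subset_span (Or.inr ⟨i, rfl⟩)
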